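/- Let $K/\mathbb{Q}$ be a finite Galois extension with group $G$ that is quadratically ramified, i.e. every inertia subgroup of $G$ at a finite prime has order $1$ or $2$, and suppose that the discriminant $D_K$ is odd. For each prime $p\mid D_K$ let $K_p$ be the completion of $K$ at a prime above $p$, and let $d_p$ be the discriminant of a totally ramified quadratic subextension of $K_p/\mathbb{Q}_p$ or, in case $K_p/\mathbb{Q}_p$ has no such subextension, of a totally ramified quadratic extension of $\mathbb{Q}_p$. Here the discriminant of a quadratic extension of $\mathbb{Q}_p$ ($p$ odd) is taken to be the integer $\pm p^k$ that generates its discriminant ideal, with the sign chosen such that it is $\equiv 1 \pmod 4$. For $p\nmid D_K$ let $d_p=1$, and put $\hat d=\prod_p d_p$. Then: 1. if $K\neq\mathbb{Q}$, then $\hat d$ is a fundamental quadratic discriminant, i.e. the discriminant of a quadratic number field; 2. $K\cdot\mathbb{Q}(\sqrt{\hat d})/\mathbb{Q}(\sqrt{\hat d})$ is unramified at all finite primes. -/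

import Mathlib

open NumberField IsDedekindDomain

noncomputable section

/-- A Galois number field is quadratically ramified if the inertia group in `Gal(K/ℚ)` of every
nonzero prime of `𝓞 K` has order `1` or `2`. -/
def IsQuadraticallyRamified (K : Type*) [Field K] [NumberField K] : Prop :=
  ∀ P : Ideal (𝓞 K), P.IsPrime → P ≠ ⊥ →
    Nat.card (P.inertia Gal(K/ℚ)) = 1 ∨ Nat.card (P.inertia Gal(K/ℚ)) = 2

/-- `d` is the discriminant of a quadratic number field. -/
def IsQuadraticDiscriminant (d : ℤ) : Prop :=
  ∃ (k : Type) (_ : Field k) (_ : NumberField k), Module.finrank ℚ k = 2 ∧ discr k = d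

/-- `M/F` is unramified at every nonzero prime of `𝓞 M`. -/
def IsUnramifiedAtFinitePrimes (F M : Type*) [Field F] [NumberField F] [Field M] [NumberField M]
    [Algebra F M] : Prop :=
  ∀ P : Ideal (𝓞 M), P.IsPrime → P ≠ ⊥ → P.ramificationIdx (𝓞 F) = 1

section Local

variable (p : ℕ) [Fact p.Prime]

/-- The `ℤ_p`-algebra structure of an extension `L` of `ℚ_p`. -/
abbrev padicIntAlgebra (L : Type*) [Field L] [Algebra ℚ_[p] L] : Algebra ℤ_[p] L :=
  Algebra.compHom L (algebraMap ℤ_[p] ℚ_[p])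

/-- `L/ℚ_p` is quadratic and totally ramified: `[L : ℚ_p] = 2`, and the ring of integers of `L`
has a nonzero prime whose ramification index over `ℤ_p` is `2`. -/
def IsTotallyRamifiedQuadratic (L : Type*) [Field L] [Algebra ℚ_[p] L] : Prop :=
  letI : Algebra ℤ_[p] L := padicIntAlgebra p L
  Module.finrank ℚ_[p] L = 2 ∧
    ∃ P : Ideal (integralClosure ℤ_[p] L), P.IsPrime ∧ P ≠ ⊥ ∧ P.ramificationIdx ℤ_[p] = 2

/-- The integer `d` is the discriminant of the quadratic extension `L/ℚ_p` (for odd `p`): it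
generates the discriminant ideal of `L/ℚ_p`, i.e. it agrees up to a unit of `ℤ_p` with the
discriminant of a `ℤ_p`-basis of the ring of integers of `L`, and it is normalized by being, up to
sign, a power of `p`, with the sign that makes it congruent to `1` modulo `4`. -/
def IsLocalDiscriminant (L : Type*) [Field L] [Algebra ℚ_[p] L] (d : ℤ) : Prop :=
  letI : Algebra ℤ_[p] L := padicIntAlgebra p L
  (∃ b : Module.Basis (Fin 2) ℤ_[p] (integralClosure ℤ_[p] L),
      Associated (Algebra.discr ℤ_[p] b) (d : ℤ_[p])) ∧
    (∃ k : ℕ, d.natAbs = p ^ k) ∧ d ≡ 1 [ZMOD 4]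

variable (K : Type*) [Field K] [NumberField K]

/-- For some prime `v` of `K` above `p`, the completion `K_v` of `K` at `v` has a subextension
`L/ℚ_p` which is quadratic, totally ramified, and has the further property `Q`. Here `K_v` is an
extension of `ℚ_p` through the (unique) continuous ring homomorphism `ℚ_p → K_v`. If `K/ℚ` is
Galois, then the extensions `K_v/ℚ_p` for the various `v` above `p` are all isomorphic. -/
def HasTotallyRamifiedQuadraticSubextension
    (Q : ∀ (L : Type _) [Field L] [Algebra ℚ_[p] L], Prop) : Prop :=
  ∃ v : HeightOneSpectrum (𝓞 K), (p : 𝓞 K) ∈ v.asIdeal ∧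
    ∃ ι : ℚ_[p] →+* v.adicCompletion K, Continuous ι ∧
      letI : Algebra ℚ_[p] (v.adicCompletion K) := ι.toAlgebra
      ∃ L : IntermediateField ℚ_[p] (v.adicCompletion K), IsTotallyRamifiedQuadratic p L ∧ Q L

/-- `d` is the discriminant `d_p` attached to `K` at an odd ramified prime `p`: the discriminant of
a totally ramified quadratic subextension of `K_p/ℚ_p` or, in case `K_p/ℚ_p` has no such
subextension, of a totally ramified quadratic extension of `ℚ_p`. -/
def IsRamifiedLocalDiscriminant (d : ℤ) : Prop :=
  HasTotallyRamifiedQuadraticSubextension p K (fun L => IsLocalDiscriminant p L d) ∨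
    (¬ HasTotallyRamifiedQuadraticSubextension p K (fun _ => True) ∧
      ∃ L : IntermediateField ℚ_[p] (PadicAlgCl p),
        IsTotallyRamifiedQuadratic p L ∧ IsLocalDiscriminant p L d)

end Local

end

/-!
For an odd ramified prime `p` the number `d_p` is `±p`, whichever field it is taken from: the ring of
integers of a totally ramified quadratic extension of `ℚ_p` has a `ℤ_p`-basis `1, x` with `x ^ 2 = D`
in `ℤ_p`, where `D` is not a unit because of the ramification, and is not divisible by `p ^ 2`
because the ring is integrally closed (`discr_associated_of_ramificationIdx_eq_two`). Hence the
product `δ` of the `d_p` is squarefree, congruent to `1` modulo `4`, and has the same prime divisors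
as `D_K`. By Minkowski's bound `δ ≠ 1` for `K ≠ ℚ`, and then `δ` is the discriminant of `ℚ(√δ)`
(`isQuadraticDiscriminant_of_squarefree`).

Let `F = ℚ(√δ)` and `M = K F`, let `P` be a prime of `M` above `p`, and let `I` be its inertia group
in `Gal(M/ℚ)`, of order `e(P/ℚ) = e(P/F) e(P_F/ℚ)`. An element of `I` restricts to an inertia
element of `K`, and it is determined by this restriction together with its effect on `√δ`.
* If `p ∤ D_K`, then both are trivial, so `I = 1` and `e(P/F) = 1`.
* If `p ∣ D_K`, then every element of `I` has square `1`. As `p` is odd, such an inertia group has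
  order at most `2` (`card_inertia_le_two`): its elements act by `1` or `-1` on the line `P / P ^ 2`,
  and an involution acting by `1` there acts trivially on all `P ^ k / P ^ (k + 1)`, hence is
  trivial. On the other hand `e(P_F/ℚ) ≥ 2`, because `p` divides `δ` exactly once. So `e(P/F) = 1`.
-/

/-! ### Discriminants of quadratic algebras and local discriminants -/

theorem Algebra.discr_eq_det_toMatrix_sq_mul {A B ι : Type*} [CommRing A] [CommRing B]
    [Algebra A B] [Fintype ι] [DecidableEq ι] (b : Module.Basis ι A B) (v : ι → B) :
    Algebra.discr A v = (b.toMatrix v).det ^ 2 * Algebra.discr A b := by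
  rw [← Algebra.discr_of_matrix_vecMul]
  congr 1
  ext i
  rw [Matrix.vecMul_eq_sum]
  simp only [Finset.sum_apply, Pi.smul_apply, Matrix.map_apply, smul_eq_mul]
  conv_lhs => rw [← b.sum_toMatrix_smul_self v i]
  exact Finset.sum_congr rfl fun j _ => by rw [Algebra.smul_def, mul_comm]

theorem Algebra.discr_basis_associated {A B ι : Type*} [CommRing A] [CommRing B] [Algebra A B]
    [Fintype ι] [DecidableEq ι] (b b' : Module.Basis ι A B) :
    Associated (Algebra.discr A b) (Algebra.discr A b') := by
  have hu : IsUnit (b.toMatrix b').det := by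
    have := b.isUnit_det b'
    rwa [Module.Basis.det_apply] at this
  rw [Algebra.discr_eq_det_toMatrix_sq_mul b b', mul_comm]
  exact associated_mul_unit_right _ _ (hu.pow 2)

/-- The discriminant of a basis `1, y` of a quadratic algebra is that of the polynomial
`X ^ 2 - t X - n` of which `y` is a root. -/
theorem Algebra.discr_of_basis_one_of_sq {A B : Type*} [CommRing A] [CommRing B] [Algebra A B]
    (b : Module.Basis (Fin 2) A B) (hb : b 0 = 1) (t n : A)
    (h : b 1 ^ 2 = algebraMap A B n + algebraMap A B t * b 1) :
    Algebra.discr A b = t ^ 2 + 4 * n := by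
  have hfr : Algebra.trace A B 1 = 2 := by
    have := Algebra.trace_algebraMap_of_basis b (1 : A)
    simpa using this
  have htr : Algebra.trace A B (b 1) = t := by
    rw [Algebra.trace_eq_matrix_trace b, Matrix.trace_fin_two, Algebra.leftMulMatrix_eq_repr_mul,
      Algebra.leftMulMatrix_eq_repr_mul, hb, mul_one, ← pow_two, h, ← Algebra.smul_def]
    have : algebraMap A B n = n • b 0 := by rw [hb, Algebra.smul_def, mul_one]
    simp [this]
  have hsq : Algebra.trace A B (b 1 * b 1) = 2 * n + t * t := by
    rw [← pow_two, h, ← Algebra.smul_def, map_add, map_smul, htr,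
      Algebra.trace_algebraMap_of_basis b]
    simp
  rw [Algebra.discr_def, Matrix.det_fin_two]
  simp only [Algebra.traceMatrix_apply, Algebra.traceForm_apply, hb, one_mul, mul_one, hfr, htr,
    hsq]
  ring

/-- A free quadratic algebra over a local ring `A` in which `2` is invertible has a basis `1, x`
with `x ^ 2 ∈ A`: complete the square. -/
theorem exists_basis_one_sq_eq {A B : Type*} [CommRing A] [IsLocalRing A] [CommRing B]
    [Algebra A B] (h2 : IsUnit (2 : A)) (b : Module.Basis (Fin 2) A B)
    (hB : (IsLocalRing.maximalIdeal A).map (algebraMap A B) ≠ ⊤) :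
    ∃ (b' : Module.Basis (Fin 2) A B) (D : A), b' 0 = 1 ∧ b' 1 ^ 2 = algebraMap A B D := by
  -- after renumbering the basis, the coefficient of `1` at `b 0` is a unit
  wlog hu : IsUnit (b.repr 1 0) generalizing b with H
  · refine H (b.reindex (Equiv.swap 0 1)) ?_
    by_contra hv
    have hv : ¬ IsUnit (b.repr 1 1) := by simpa using hv
    refine hB ((Ideal.eq_top_iff_one _).2 ?_)
    rw [← b.sum_repr 1, Fin.sum_univ_two, Algebra.smul_def, Algebra.smul_def]
    exact Ideal.add_mem _
      (Ideal.mul_mem_right _ _ (Ideal.mem_map_of_mem _ ((IsLocalRing.mem_maximalIdeal _).2 hu)))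
      (Ideal.mul_mem_right _ _ (Ideal.mem_map_of_mem _ ((IsLocalRing.mem_maximalIdeal _).2 hv)))
  obtain ⟨u, hu⟩ := hu
  set v := b.repr 1 1 with hv
  have h1 : (1 : B) = (u : A) • b 0 + v • b 1 := by
    conv_lhs => rw [← b.sum_repr 1, Fin.sum_univ_two, ← hu]
  have hb0 : b 0 = (↑u⁻¹ : A) • ((1 : B) - v • b 1) := by
    rw [h1, add_sub_cancel_right, smul_smul, Units.inv_mul, one_smul]
  obtain ⟨w, hw⟩ := h2
  -- `b 1 ^ 2 = α + β * b 1`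
  obtain ⟨α, β, hαβ⟩ : ∃ α β : A, b 1 ^ 2 = α • (1 : B) + β • b 1 := by
    have := b.sum_repr (b 1 ^ 2)
    rw [Fin.sum_univ_two, hb0] at this
    refine ⟨b.repr (b 1 ^ 2) 0 * ↑u⁻¹, b.repr (b 1 ^ 2) 1 - b.repr (b 1 ^ 2) 0 * ↑u⁻¹ * v, ?_⟩
    refine this.symm.trans ?_
    simp only [Algebra.smul_def, map_sub, map_mul]
    ring
  let c : A := ↑w⁻¹ * β
  have hc : β = 2 * c := by simp [c, ← hw]
  let x : B := b 1 - c • (1 : B)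
  have hli : LinearIndependent A ![(1 : B), x] := by
    rw [LinearIndependent.pair_iff]
    intro r s hrs
    have e : r • (1 : B) + s • x = ((r - s * c) * u) • b 0 + ((r - s * c) * v + s) • b 1 := by
      have : r • (1 : B) + s • x = (r - s * c) • (1 : B) + s • b 1 := by
        simp only [x, smul_sub, sub_smul, smul_smul]; abel
      rw [this]
      conv_lhs => rw [h1]
      simp only [smul_add, add_smul, smul_smul]; abel
    rw [e] at hrs
    have hl := b.linearIndependent
    rw [Fintype.linearIndependent_iff] at hl
    have h := hl ![(r - s * c) * u, (r - s * c) * v + s] (by simpa [Fin.sum_univ_two] using hrs)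
    have h0 : (r - s * c) * u = 0 := by simpa using h 0
    have h1 : (r - s * c) * v + s = 0 := by simpa using h 1
    have h0' : r - s * c = 0 := (Units.mul_left_eq_zero u).1 h0
    have hs : s = 0 := by simpa [h0'] using h1
    exact ⟨by simpa [hs] using h0', hs⟩
  have hsp : ⊤ ≤ Submodule.span A (Set.range ![(1 : B), x]) := by
    have m1 : (1 : B) ∈ Submodule.span A (Set.range ![(1 : B), x]) :=
      Submodule.subset_span ⟨0, rfl⟩
    have mx : x ∈ Submodule.span A (Set.range ![(1 : B), x]) := Submodule.subset_span ⟨1, rfl⟩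
    have mb1 : b 1 ∈ Submodule.span A (Set.range ![(1 : B), x]) := by
      have : b 1 = x + c • (1 : B) := by simp [x]
      rw [this]
      exact add_mem mx (Submodule.smul_mem _ _ m1)
    rw [← b.span_eq, Submodule.span_le]
    rintro _ ⟨i, rfl⟩
    fin_cases i
    · change b 0 ∈ _
      rw [hb0]
      exact Submodule.smul_mem _ _ (sub_mem m1 (Submodule.smul_mem _ _ mb1))
    · exact mb1
  refine ⟨Module.Basis.mk hli hsp, α + c ^ 2, by simp, ?_⟩
  simp only [Module.Basis.mk_apply, Matrix.cons_val_one, Matrix.cons_val_fin_one, x]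
  rw [sub_sq, hαβ, hc]
  simp only [Algebra.smul_def, map_add, map_mul, map_pow, map_ofNat]
  ring

/-- The discriminant of a quadratic extension of discrete valuation rings with ramification index
`2` is a uniformizer, provided that `2` is invertible. -/
theorem discr_associated_of_ramificationIdx_eq_two {A B : Type*} [CommRing A] [IsDomain A]
    [IsDiscreteValuationRing A] [CommRing B] [IsDedekindDomain B] [Algebra A B]
    (h2 : IsUnit (2 : A)) (b : Module.Basis (Fin 2) A B) {P : Ideal B} (hP : P.IsPrime)
    (hP0 : P ≠ ⊥) (he : P.ramificationIdx A = 2) {ϖ : A} (hϖ : Irreducible ϖ) :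
    Associated (Algebra.discr A b) ϖ := by
  have : Module.Finite A B := Module.Finite.of_basis b
  have : Module.Free A B := Module.Free.of_basis b
  have hϖ0 := hϖ.ne_zero
  have hpr : Prime ϖ := hϖ.prime
  have hmax := hϖ.maximalIdeal_eq
  have hlies : P.LiesOver (IsLocalRing.maximalIdeal A) := by
    refine ⟨(IsLocalRing.eq_maximalIdeal ?_).symm⟩
    have h0 : P.under A ≠ ⊥ := Ideal.IsIntegral.comap_ne_bot A hP0
    exact (inferInstance : (P.under A).IsPrime).isMaximal h0
  have hm0 : IsLocalRing.maximalIdeal A ≠ ⊥ := IsDiscreteValuationRing.not_a_field A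
  have hle : (IsLocalRing.maximalIdeal A).map (algebraMap A B) ≤ P ^ 2 := by
    rw [← he, ← Ideal.ramificationIdx'_eq_ramificationIdx _ P hm0]
    exact Ideal.le_pow_ramificationIdx'
  obtain ⟨b', D, hb0, hb1⟩ := exists_basis_one_sq_eq h2 b
    (fun h => (hP.ne_top (top_le_iff.1 (h ▸ hle.trans (Ideal.pow_le_self two_ne_zero)))))
  have hdisc : Algebra.discr A b' = 4 * D := by
    rw [Algebra.discr_of_basis_one_of_sq b' hb0 0 D (by simpa using hb1)]
    ring
  have hrepr (a c : A) (z : B) (h : a • b' 0 + c • b' 1 = z) :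
      b'.repr z 0 = a ∧ b'.repr z 1 = c := by
    rw [← h]; simp
  have hdvd (z : B) (h : algebraMap A B ϖ ∣ z) (i : Fin 2) : ϖ ∣ b'.repr z i := by
    obtain ⟨y, rfl⟩ := h
    rw [← Algebra.smul_def]
    simp
  have hinj : algebraMap A B ϖ ≠ 0 := by
    rw [ne_eq, map_eq_zero_iff _ (FaithfulSMul.algebraMap_injective A B)]
    exact hϖ0
  -- a unit `D` would make `B / ϖ B` reduced
  have hD : ϖ ∣ D := by
    by_contra hD
    rw [hmax, Ideal.map_span, Set.image_singleton, ← Ideal.dvd_iff_le] at hle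
    obtain ⟨J, hJ⟩ := hle
    have hJ0 : J ≠ ⊥ := by
      rintro rfl
      rw [Ideal.mul_bot, Ideal.span_singleton_eq_bot] at hJ
      exact hinj hJ
    have key : P * J ≤ P ^ 2 * J := by
      intro z hz
      have hz2 : z ^ 2 ∈ Ideal.span {algebraMap A B ϖ} := by
        rw [hJ]
        have : (P * J) ^ 2 ≤ P ^ 2 * J := by
          rw [mul_pow]
          exact Ideal.mul_mono_right (Ideal.pow_le_self two_ne_zero)
        exact this (Ideal.pow_mem_pow hz 2)
      rw [← hJ, Ideal.mem_span_singleton]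
      rw [Ideal.mem_span_singleton] at hz2
      have hz := b'.sum_repr z
      rw [Fin.sum_univ_two] at hz
      set a := b'.repr z 0
      set c := b'.repr z 1
      have hsq : (a ^ 2 + c ^ 2 * D) • b' 0 + (2 * a * c) • b' 1 = z ^ 2 := by
        rw [← hz, hb0]
        simp only [Algebra.smul_def, map_add, map_mul, map_pow, map_ofNat]
        linear_combination (algebraMap A B c) ^ 2 * (-hb1)
      obtain ⟨e0, e1⟩ := hrepr _ _ _ hsq
      have d0 := hdvd _ hz2 0
      have d1 := hdvd _ hz2 1
      rw [e0] at d0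
      rw [e1, mul_assoc] at d1
      have hac : ϖ ∣ a ∧ ϖ ∣ c := by
        rcases hpr.dvd_or_dvd (h2.dvd_mul_left.1 d1) with h | h
        · refine ⟨h, ?_⟩
          have := (dvd_add_right (dvd_pow h two_ne_zero)).1 d0
          exact hpr.dvd_of_dvd_pow ((hpr.dvd_or_dvd this).resolve_right hD)
        · refine ⟨?_, h⟩
          have := (dvd_add_left ((dvd_pow h two_ne_zero).mul_right D)).1 d0
          exact hpr.dvd_of_dvd_pow this
      rw [← hz, Algebra.smul_def, Algebra.smul_def]
      exact dvd_add ((map_dvd _ hac.1).mul_right _) ((map_dvd _ hac.2).mul_right _)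
    have h' : P * J * P ∣ P * J * 1 := by
      rw [mul_one, mul_right_comm, ← pow_two]
      exact Ideal.dvd_iff_le.2 key
    have := (mul_dvd_mul_iff_left (mul_ne_zero hP0 hJ0)).1 h'
    exact hP.ne_top (top_le_iff.1 (by simpa using Ideal.dvd_iff_le.1 this))
  -- if `ϖ ^ 2` divided `D`, then `b' 1 / ϖ` would be integral
  have hD2 : ¬ ϖ ^ 2 ∣ D := by
    intro h
    have h' : algebraMap A B ϖ ^ 2 ∣ b' 1 ^ 2 := by
      rw [hb1, ← map_pow]
      exact map_dvd _ h
    have := hdvd _ ((IsIntegrallyClosed.pow_dvd_pow_iff two_ne_zero).1 h') 1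
    rw [Module.Basis.repr_self, Finsupp.single_eq_same] at this
    exact hϖ.not_isUnit (isUnit_of_dvd_one this)
  refine (Algebra.discr_basis_associated b b').trans ?_
  rw [hdisc]
  obtain ⟨e, rfl⟩ := hD
  have hu : IsUnit e := by
    by_contra hn
    have : ϖ ∣ e := by
      rw [← Ideal.mem_span_singleton, ← hmax]
      exact hn
    exact hD2 (by rw [pow_two]; exact mul_dvd_mul_left _ this)
  have h4 : IsUnit (4 : A) := by
    have := h2.mul h2
    norm_num at this
    exact this
  rw [show 4 * (ϖ * e) = ϖ * (4 * e) by ring]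
  exact associated_mul_unit_left _ _ (h4.mul hu)

/-- For odd `p`, the normalized discriminant of a totally ramified quadratic extension of `ℚ_p` is
`p` or `-p`. -/
theorem IsLocalDiscriminant.natAbs_eq {p : ℕ} [Fact p.Prime] (hp2 : p ≠ 2) {L : Type*} [Field L]
    [Algebra ℚ_[p] L] (hL : IsTotallyRamifiedQuadratic p L) {d : ℤ}
    (hd : IsLocalDiscriminant p L d) : d.natAbs = p := by
  let : Algebra ℤ_[p] L := padicIntAlgebra p L
  have : IsScalarTower ℤ_[p] ℚ_[p] L := IsScalarTower.of_algebraMap_eq fun _ => rfl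
  obtain ⟨hfr, P, hP, hP0, he⟩ := hL
  obtain ⟨⟨b, hb⟩, ⟨k, hk⟩, -⟩ := hd
  have : FiniteDimensional ℚ_[p] L := Module.finite_of_finrank_pos (by omega)
  have : IsDedekindDomain (integralClosure ℤ_[p] L) :=
    integralClosure.isDedekindDomain ℤ_[p] ℚ_[p] L
  have hp : p.Prime := Fact.out
  have h2 : IsUnit (2 : ℤ_[p]) := by
    rw [PadicInt.isUnit_iff]
    have := (PadicInt.norm_natCast_eq_one_iff (p := p) (n := 2)).2
      ((Nat.coprime_primes hp Nat.prime_two).2 hp2)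
    exact_mod_cast this
  have hirr : Irreducible (p : ℤ_[p]) := PadicInt.irreducible_p
  have hass := hb.symm.trans (discr_associated_of_ramificationIdx_eq_two h2 b hP hP0 he hirr)
  have hass' : Associated ((p : ℤ_[p]) ^ k) (p : ℤ_[p]) := by
    refine Associated.trans ?_ hass
    rcases Int.natAbs_eq d with h | h <;> rw [h, hk] <;> push_cast
    · exact Associated.refl _
    · exact (Associated.refl _).neg_right
  have : k = 1 := by
    have h1 : k ≤ 1 := (pow_dvd_pow_iff hirr.ne_zero hirr.not_isUnit).1
      (by simpa using hass'.dvd)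
    have h2 : k ≠ 0 := by
      rintro rfl
      exact hirr.not_isUnit (isUnit_of_dvd_one (by simpa using hass'.symm.dvd))
    omega
  rw [hk, this, pow_one]

theorem IsRamifiedLocalDiscriminant.natAbs_eq {p : ℕ} [Fact p.Prime] (hp2 : p ≠ 2) {K : Type*}
    [Field K] [NumberField K] {d : ℤ} (hd : IsRamifiedLocalDiscriminant p K d) :
    d.natAbs = p ∧ d ≡ 1 [ZMOD 4] := by
  rcases hd with ⟨v, -, ι, -, L, hL, hLd⟩ | ⟨-, L, hL, hLd⟩
  · let : Algebra ℚ_[p] (v.adicCompletion K) := ι.toAlgebra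
    exact ⟨hLd.natAbs_eq hp2 hL, hLd.2.2⟩
  · exact ⟨hLd.natAbs_eq hp2 hL, hLd.2.2⟩

/-! ### Discriminants of quadratic number fields -/

open Polynomial in
/-- A squarefree `d ≡ 1 mod 4` other than `1` is the discriminant of `ℚ(√d)`, realized as
`ℚ[X] / (X ^ 2 - X - (d - 1) / 4)`. -/
theorem isQuadraticDiscriminant_of_squarefree {d : ℤ} (hsq : Squarefree d) (h4 : d ≡ 1 [ZMOD 4])
    (h1 : d ≠ 1) : IsQuadraticDiscriminant d := by
  obtain ⟨m, hm⟩ : ∃ m : ℤ, d = 1 + 4 * m := by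
    obtain ⟨m, hm⟩ := h4.symm.dvd
    exact ⟨m, by linarith⟩
  -- `d` is not a rational square
  have hns (q : ℚ) : q ^ 2 ≠ d := by
    intro h
    obtain ⟨n, rfl⟩ : ∃ n : ℤ, (n : ℚ) = q := by
      have : IsIntegral ℤ q := by
        refine IsIntegral.of_pow two_pos ?_
        rw [h]
        exact isIntegral_algebraMap (R := ℤ) (x := d)
      exact IsIntegrallyClosed.isIntegral_iff.1 this
    have h : d = n * n := by
      rw [← pow_two]
      exact_mod_cast h.symm
    have hu := hsq n (by rw [h])
    exact h1 (h.trans (Int.isUnit_mul_self hu))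
  let fZ : ℤ[X] := X ^ 2 - X - C m
  let f : ℚ[X] := X ^ 2 - X - C (m : ℚ)
  have hdeg : f.natDegree = 2 := by simp only [f]; compute_degree!
  have hmon : f.Monic := by simp only [f]; monicity!
  have hmonZ : fZ.Monic := by simp only [fZ]; monicity!
  have hirr : Irreducible f := by
    rw [hmon.irreducible_iff_roots_eq_zero_of_degree_le_three (by omega) (by omega)]
    refine Multiset.eq_zero_of_forall_notMem fun q hq => ?_
    have h := (mem_roots'.1 hq).2
    simp only [f, IsRoot.def, eval_sub, eval_pow, eval_X, eval_C] at h
    apply hns (2 * q - 1)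
    rw [hm]
    push_cast
    linear_combination 4 * h
  have : Fact (Irreducible f) := ⟨hirr⟩
  let k := AdjoinRoot f
  let pb : PowerBasis ℚ k := AdjoinRoot.powerBasis hirr.ne_zero
  have hdim : pb.dim = 2 := by rw [AdjoinRoot.powerBasis_dim, hdeg]
  have : FiniteDimensional ℚ k := pb.finite
  have : CharZero k := algebraRat.charZero k
  have : NumberField k := ⟨⟩
  have hfr : Module.finrank ℚ k = 2 := by rw [pb.finrank, hdim]
  refine ⟨k, inferInstance, inferInstance, hfr, ?_⟩
  have hroot : AdjoinRoot.root f ^ 2 = AdjoinRoot.root f + (m : k) := by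
    have h (g : ℚ →+* k) (r : k) : f.eval₂ g r = r ^ 2 - r - m := by
      simp only [f, eval₂_sub, eval₂_pow, eval₂_X, eval₂_C]
      rw [map_intCast]
    linear_combination (h _ _).symm.trans (AdjoinRoot.eval₂_root f)
  have hint : IsIntegral ℤ (AdjoinRoot.root f : k) := by
    refine ⟨fZ, hmonZ, ?_⟩
    simp only [fZ, eval₂_sub, eval₂_pow, eval₂_X, eval₂_C, hroot]
    simp
  let w : 𝓞 k := ⟨AdjoinRoot.root f, hint⟩
  let b : Module.Basis (Fin 2) ℚ k := pb.basis.reindex (finCongr hdim)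
  have hb0 : b 0 = 1 := by simp [b]
  have hb1 : b 1 = AdjoinRoot.root f := by simp [b, pb]
  have hdb : Algebra.discr ℚ b = d := by
    rw [Algebra.discr_of_basis_one_of_sq b hb0 1 m (by rw [hb1, hroot]; simp [add_comm]), hm]
    push_cast
    ring
  let v : Fin 2 → 𝓞 k := ![1, w]
  have hdv : Algebra.discr ℤ v = d := by
    apply Int.cast_injective (α := ℚ)
    rw [← hdb, Algebra.discr_def, Algebra.discr_def, ← eq_intCast (algebraMap ℤ ℚ),
      RingHom.map_det]
    congr 1
    ext i j
    have hv (i : Fin 2) : ((v i : 𝓞 k) : k) = b i := by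
      fin_cases i
      · exact hb0.symm
      · exact hb1.symm
    simp only [RingHom.mapMatrix_apply, Matrix.map_apply, Algebra.traceMatrix_apply,
      Algebra.traceForm_apply, ← hv, ← map_mul]
    exact (Algebra.trace_localization ℤ (nonZeroDivisors ℤ) (v i * v j)).symm
  -- the discriminant of the order `ℤ[w]` is `d`, which is squarefree, so this order is maximal
  have hcard : Fintype.card (Module.Free.ChooseBasisIndex ℤ (𝓞 k)) = Fintype.card (Fin 2) := by
    rw [← Module.finrank_eq_card_chooseBasisIndex, RingOfIntegers.rank, hfr, Fintype.card_fin]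
  let bZ := (RingOfIntegers.basis k).reindex (Fintype.equivOfCardEq hcard)
  rw [Algebra.discr_eq_det_toMatrix_sq_mul bZ, NumberField.discr_eq_discr] at hdv
  have hu := hsq (bZ.toMatrix v).det ⟨discr k, by rw [← hdv, pow_two]⟩
  rw [← hdv, pow_two, Int.isUnit_mul_self hu, one_mul]

/-! ### Inertia groups of exponent two -/

/-- An involution of a Dedekind domain acting trivially on `S / P` and on `P / P ^ 2` is trivial
if `2 ∉ P`: it acts trivially on every `P ^ k / P ^ (k + 1)`, while it is `-1` on `σ x - x`. -/
theorem smul_eq_of_sub_mem_sq {S G : Type*} [CommRing S] [IsDedekindDomain S] [Group G]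
    [MulSemiringAction G S] {P : Ideal S} (hP : P.IsPrime) (h2 : (2 : S) ∉ P) {σ : G}
    (hσ2 : σ ^ 2 = 1) (h0 : σ ∈ P.inertia G) (h1 : ∀ x ∈ P, σ • x - x ∈ P ^ 2) (x : S) :
    σ • x = x := by
  have hk (k : ℕ) : ∀ x ∈ P ^ k, σ • x - x ∈ P ^ (k + 1) := by
    induction k with
    | zero => intro x _; simpa using h0 x
    | succ k ih =>
      intro x hx
      rw [pow_succ] at hx
      induction hx using Submodule.mul_induction_on' with
      | mem_mul_mem a ha b hb =>
        have hσb : σ • b ∈ P := by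
          have := P.add_mem (h0 b) hb
          simpa using this
        have : σ • (a * b) - a * b = (σ • a - a) * (σ • b) + a * (σ • b - b) := by
          rw [smul_mul']; ring
        rw [this]
        refine add_mem ?_ ?_
        · rw [pow_succ]
          exact Ideal.mul_mem_mul (ih a ha) hσb
        · rw [add_assoc, pow_add]
          exact Ideal.mul_mem_mul ha (h1 b hb)
      | add a _ b _ ha hb =>
        rw [smul_add, add_sub_add_comm]
        exact add_mem ha hb
  set y := σ • x - x with hy
  have hσy : σ • y = -y := by
    rw [hy, smul_sub, smul_smul, ← pow_two, hσ2, one_smul, neg_sub]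
  have hyk (k : ℕ) : y ∈ P ^ k := by
    induction k with
    | zero => simp
    | succ k ih =>
      have h := hk k y ih
      rw [hσy, show -y - y = -(2 * y) by ring, neg_mem_iff] at h
      by_cases hP0 : P = ⊥
      · rw [hP0, Ideal.bot_pow (Nat.succ_ne_zero k), Ideal.mem_bot] at h ⊢
        exact (mul_eq_zero.1 h).resolve_left fun h => h2 (h ▸ P.zero_mem)
      · exact (hP.mul_mem_pow P h).resolve_left h2
  have := Ideal.iInf_pow_eq_bot_of_isDomain P hP.ne_top
  have : y ∈ (⊥ : Ideal S) := by
    rw [← this, Ideal.mem_iInf]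
    exact hyk
  exact sub_eq_zero.1 ((Ideal.mem_bot).1 this)

/-- An element of the inertia group of order dividing `2` acts on the line `P / P ^ 2` as `1` or
as `-1`. -/
theorem sub_mem_sq_or_add_mem_sq {S G : Type*} [CommRing S] [IsDedekindDomain S] [Group G]
    [MulSemiringAction G S] {P : Ideal S} (hP : P.IsPrime) (hP0 : P ≠ ⊥) {σ : G}
    (hσ2 : σ ^ 2 = 1) (h0 : σ ∈ P.inertia G) :
    (∀ x ∈ P, σ • x - x ∈ P ^ 2) ∨ (∀ x ∈ P, σ • x + x ∈ P ^ 2) := by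
  obtain ⟨π, hπ, hπ2⟩ : ∃ π ∈ P, π ∉ P ^ 2 := by
    have := Ideal.pow_succ_lt_pow hP0 1
    rw [pow_one] at this
    exact SetLike.exists_of_lt this
  have hgen (x : S) (hx : x ∈ P) : ∃ c, ∃ e ∈ P ^ 2, π * c + e = x :=
    Ideal.exists_mul_add_mem_pow_succ hP0 (i := 1) π x (by simpa) hπ2 (by simpa)
  have hσP {x : S} (hx : x ∈ P) : σ • x ∈ P := by
    have := P.add_mem (h0 x) hx
    simpa using this
  have hσP2 {x : S} (hx : x ∈ P ^ 2) : σ • x ∈ P ^ 2 := by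
    rw [pow_two] at hx ⊢
    induction hx using Submodule.mul_induction_on' with
    | mem_mul_mem a ha b hb =>
      rw [smul_mul']
      exact Ideal.mul_mem_mul (hσP ha) (hσP hb)
    | add a _ b _ ha hb =>
      rw [smul_add]
      exact add_mem ha hb
  obtain ⟨c, e, he, hc⟩ := hgen (σ • π) (hσP hπ)
  -- the eigenvalue `c` satisfies `c ^ 2 = 1`
  have hcc : π * ((c - 1) * (c + 1)) ∈ P ^ 2 := by
    have h1 : σ • (σ • π) = π := by rw [smul_smul, ← pow_two, hσ2, one_smul]
    have h2 : σ • (π * c + e) = π := by rw [hc, h1]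
    rw [smul_add, smul_mul'] at h2
    have h3 : π * ((c - 1) * (c + 1)) = -(σ • π * (σ • c - c) + σ • e + c * e) := by
      linear_combination h2 + c * hc
    rw [h3]
    refine neg_mem (add_mem (add_mem ?_ (hσP2 he)) (Ideal.mul_mem_left _ _ he))
    rw [pow_two]
    exact Ideal.mul_mem_mul (hσP hπ) (h0 c)
  have hcP : (c - 1) * (c + 1) ∈ P := Ideal.mem_prime_of_mul_mem_pow hP0 hπ2 hcc
  rcases hP.mem_or_mem hcP with h | h
  · left
    intro x hx
    obtain ⟨a, e', he', rfl⟩ := hgen x hx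
    have : σ • (π * a + e') - (π * a + e') =
        σ • π * (σ • a - a) + π * (c - 1) * a + (e * a + σ • e' - e') := by
      rw [smul_add, smul_mul']
      linear_combination (-a) * hc
    rw [this]
    refine add_mem (add_mem ?_ (Ideal.mul_mem_right _ _ ?_))
      (sub_mem (add_mem (Ideal.mul_mem_right _ _ he) (hσP2 he')) he')
    · rw [pow_two]
      exact Ideal.mul_mem_mul (hσP hπ) (h0 a)
    · rw [pow_two]
      exact Ideal.mul_mem_mul hπ h
  · right
    intro x hx
    obtain ⟨a, e', he', rfl⟩ := hgen x hx
    have : σ • (π * a + e') + (π * a + e') =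
        σ • π * (σ • a - a) + π * (c + 1) * a + (e * a + σ • e' + e') := by
      rw [smul_add, smul_mul']
      linear_combination (-a) * hc
    rw [this]
    refine add_mem (add_mem ?_ (Ideal.mul_mem_right _ _ ?_))
      (add_mem (add_mem (Ideal.mul_mem_right _ _ he) (hσP2 he')) he')
    · rw [pow_two]
      exact Ideal.mul_mem_mul (hσP hπ) (h0 a)
    · rw [pow_two]
      exact Ideal.mul_mem_mul hπ h

/-- An inertia group of exponent `2` at a prime not containing `2` has at most two elements. (It is
tame, hence cyclic.) -/
theorem card_inertia_le_two {S G : Type*} [CommRing S] [IsDedekindDomain S] [Group G]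
    [MulSemiringAction G S] [FaithfulSMul G S] {P : Ideal S} (hP : P.IsPrime) (hP0 : P ≠ ⊥)
    (h2 : (2 : S) ∉ P) (hI : ∀ σ ∈ P.inertia G, σ ^ 2 = 1) : Nat.card (P.inertia G) ≤ 2 := by
  have htriv {σ : G} (hσ : σ ∈ P.inertia G) (h : ∀ x ∈ P, σ • x - x ∈ P ^ 2) : σ = 1 :=
    FaithfulSMul.eq_of_smul_eq_smul fun x : S => by
      rw [smul_eq_of_sub_mem_sq hP h2 (hI σ hσ) hσ h x, one_smul]
  have hneg {σ : G} (hσ : σ ∈ P.inertia G) (h1 : σ ≠ 1) : ∀ x ∈ P, σ • x + x ∈ P ^ 2 :=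
    (sub_mem_sq_or_add_mem_sq hP hP0 (hI σ hσ) hσ).resolve_left fun h => h1 (htriv hσ h)
  -- two elements acting as `-1` on `P / P ^ 2` have a product acting as `1`
  have heq {σ τ : G} (hσ : σ ∈ P.inertia G) (hτ : τ ∈ P.inertia G) (h1 : σ ≠ 1) (h1' : τ ≠ 1) :
      σ = τ := by
    have hστ : σ * τ = 1 := by
      refine htriv (mul_mem hσ hτ) fun x hx => ?_
      have hτx : τ • x ∈ P := by
        have := P.add_mem (hτ x) hx
        simpa using this
      have := sub_mem (hneg hσ h1 _ hτx) (hneg hτ h1' x hx)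
      rwa [mul_smul, ← add_sub_add_right_eq_sub _ _ (τ • x), add_comm x]
    have hτ2 := hI τ hτ
    rw [pow_two] at hτ2
    exact mul_right_cancel (hστ.trans hτ2.symm)
  by_cases hbot : P.inertia G = ⊥
  · rw [hbot]
    simp
  · obtain ⟨⟨σ, hσ⟩, h1⟩ := Subgroup.ne_bot_iff_exists_ne_one.1 hbot
    have h1 : σ ≠ 1 := fun h => h1 (Subtype.ext h)
    have hsub : (P.inertia G : Set G) ⊆ {1, σ} := fun τ hτ => by
      by_cases h : τ = 1
      · exact Or.inl h
      · exact Or.inr (heq hτ hσ h h1)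
    calc Nat.card (P.inertia G) = (P.inertia G : Set G).ncard := rfl
      _ ≤ ({1, σ} : Set G).ncard := Set.ncard_le_ncard hsub (Set.toFinite _)
      _ ≤ 2 := (Set.ncard_insert_le _ _).trans (by simp)

/-! ### Inertia in a compositum with a quadratic field -/

open Polynomial in
theorem isGalois_of_adjoin_sqrt {F : Type*} [Field F] [NumberField F] {s : F} {d : ℤ}
    (hs : s ^ 2 = (d : F)) (htop : IntermediateField.adjoin ℚ {s} = ⊤) : IsGalois ℚ F := by
  have hn : Normal ℚ F := by
    refine normal_iff.2 fun x => ⟨Algebra.IsIntegral.isIntegral x, ?_⟩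
    refine IntermediateField.splits_of_mem_adjoin ℚ F (S := {s}) ?_
      (by rw [htop]; exact IntermediateField.mem_top)
    rintro y hy
    rw [Set.mem_singleton_iff.1 hy]
    refine ⟨Algebra.IsIntegral.isIntegral s, ?_⟩
    have hdvd : minpoly ℚ s ∣ X ^ 2 - C (d : ℚ) := minpoly.dvd _ _ (by simp [hs])
    have hfac : (X ^ 2 - C (d : ℚ)).map (algebraMap ℚ F) = (X + C (-s)) * (X + C s) := by
      simp only [Polynomial.map_sub, Polynomial.map_pow, map_X, map_intCast, map_neg]
      have : (C s : F[X]) ^ 2 = (d : F[X]) := by rw [← map_pow, hs, map_intCast]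
      simp
      linear_combination this
    refine Splits.of_dvd (hfac ▸ (Splits.X_add_C _).mul (Splits.X_add_C _)) ?_
      (Polynomial.map_dvd _ hdvd)
    rw [hfac]
    exact mul_ne_zero (monic_X_add_C _).ne_zero (monic_X_add_C _).ne_zero
  exact ⟨⟩

theorem isGalois_of_sup_fieldRange_eq_top {k K F M : Type*} [Field k] [Field K] [Field F] [Field M]
    [CharZero k] [Algebra k K] [Algebra k F] [Algebra k M] [IsGalois k K] [IsGalois k F]
    {f : K →ₐ[k] M} {g : F →ₐ[k] M} (h : f.fieldRange ⊔ g.fieldRange = ⊤) : IsGalois k M := by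
  have : Normal k f.fieldRange := Normal.of_algEquiv (AlgEquiv.ofInjectiveField f)
  have : Normal k g.fieldRange := Normal.of_algEquiv (AlgEquiv.ofInjectiveField g)
  have : Normal k (⊤ : IntermediateField k M) := h ▸ IntermediateField.normal_sup k M _ _
  have : Normal k M := Normal.of_algEquiv IntermediateField.topEquiv
  exact ⟨⟩

theorem algEquiv_eq_one_of_sup_fieldRange_eq_top {k K F M : Type*} [Field k] [Field K] [Field F]
    [Field M] [Algebra k K] [Algebra k F] [Algebra k M] {f : K →ₐ[k] M} {g : F →ₐ[k] M} {s : F}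
    (htop : IntermediateField.adjoin k {s} = ⊤) (h : f.fieldRange ⊔ g.fieldRange = ⊤)
    {σ : M ≃ₐ[k] M} (h1 : ∀ x, σ (f x) = f x) (h2 : σ (g s) = g s) : σ = 1 := by
  have hle : (⊤ : IntermediateField k M) ≤
      IntermediateField.fixedField (Subgroup.zpowers σ) := by
    have hmem {x : M} (hx : σ x = x) : x ∈ IntermediateField.fixedField (Subgroup.zpowers σ) := by
      rw [IntermediateField.mem_fixedField_iff]
      intro τ hτ
      have : Subgroup.zpowers σ ≤ MulAction.stabilizer (M ≃ₐ[k] M) x := by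
        rw [Subgroup.zpowers_le]
        exact hx
      exact this hτ
    rw [← h, sup_le_iff]
    constructor
    · rintro _ ⟨x, rfl⟩
      exact hmem (h1 x)
    · rw [AlgHom.fieldRange_eq_map, ← htop, IntermediateField.adjoin_map, Set.image_singleton,
        IntermediateField.adjoin_simple_le_iff]
      exact hmem h2
  ext x
  exact (IntermediateField.mem_fixedField_iff _ _).1 (hle IntermediateField.mem_top) σ
    (Subgroup.mem_zpowers σ)

/-- Inertia acts trivially on the square root of an integer `d ≡ 1 mod 4` prime to `P`: if `t` is
sent to `-t`, then the integer `(1 + t) / 2` moves by `-t`. -/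
theorem apply_eq_of_sq_eq_of_mem_inertia {M : Type*} [Field M] [NumberField M] {P : Ideal (𝓞 M)}
    {d : ℤ} (h4 : d ≡ 1 [ZMOD 4]) (hd : (d : 𝓞 M) ∉ P) {t : M} (ht : t ^ 2 = d)
    {σ : Gal(M/ℚ)} (hσ : σ ∈ P.inertia Gal(M/ℚ)) : σ t = t := by
  have h : σ t ^ 2 = t ^ 2 := by rw [← map_pow, ht, map_intCast]
  refine (sq_eq_sq_iff_eq_or_eq_neg.1 h).resolve_right fun hneg => hd ?_
  obtain ⟨m, hm⟩ := h4.symm.dvd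
  have hw : IsIntegral ℤ ((1 + t) / 2) := by
    refine ⟨Polynomial.X ^ 2 - Polynomial.X - Polynomial.C m, by monicity!, ?_⟩
    have hm' : (d : M) - 1 = 4 * m := by exact_mod_cast hm
    simp only [Polynomial.eval₂_sub, Polynomial.eval₂_pow, Polynomial.eval₂_X, Polynomial.eval₂_C]
    rw [eq_intCast]
    linear_combination ht / 4 + hm' / 4
  have hti : IsIntegral ℤ t := IsIntegral.of_pow two_pos (ht ▸ isIntegral_algebraMap (x := d))
  obtain ⟨w, hw⟩ : ∃ w : 𝓞 M, (w : M) = (1 + t) / 2 := ⟨⟨_, hw⟩, rfl⟩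
  obtain ⟨t', ht'⟩ : ∃ t' : 𝓞 M, (t' : M) = t := ⟨⟨t, hti⟩, rfl⟩
  have heq : σ • w - w = -t' := by
    apply RingOfIntegers.ext
    change σ (w : M) - (w : M) = -(t' : M)
    rw [hw, ht', map_div₀, map_add, hneg, map_one, map_ofNat]
    ring
  have hdt : (d : 𝓞 M) = t' ^ 2 := RingOfIntegers.ext (by simp [ht', ht])
  rw [hdt]
  refine Ideal.pow_mem_of_mem _ ?_ 2 two_pos
  rw [← neg_mem_iff, ← heq]
  exact hσ w

theorem restrictNormal_mem_inertia {K M : Type*} [Field K] [NumberField K] [Field M]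
    [NumberField M] [Algebra K M] [IsGalois ℚ K] {P : Ideal (𝓞 M)} {σ : Gal(M/ℚ)}
    (hσ : σ ∈ P.inertia Gal(M/ℚ)) :
    σ.restrictNormal K ∈ (P.under (𝓞 K)).inertia Gal(K/ℚ) := by
  intro x
  have h : algebraMap (𝓞 K) (𝓞 M) (σ.restrictNormal K • x - x) =
      σ • algebraMap (𝓞 K) (𝓞 M) x - algebraMap (𝓞 K) (𝓞 M) x := by
    rw [map_sub]
    congr 1
    apply RingOfIntegers.ext
    exact AlgEquiv.restrictNormal_commutes σ K (x : K)
  change algebraMap (𝓞 K) (𝓞 M) (σ.restrictNormal K • x - x) ∈ P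
  rw [h]
  exact hσ _

theorem card_inertia_eq_ramificationIdx {K : Type*} [Field K] [NumberField K] [IsGalois ℚ K]
    (P : Ideal (𝓞 K)) [P.IsPrime] :
    Nat.card (P.inertia Gal(K/ℚ)) = P.ramificationIdx ℤ := by
  rw [Ideal.card_inertia_eq_ramificationIdxIn (P.under ℤ) P,
    Ideal.ramificationIdxIn_eq_ramificationIdx (P.under ℤ) P Gal(K/ℚ)]

/-- If `p` divides `d` exactly once, then `p` ramifies in every number field containing a square
root of `d`. -/
theorem two_le_ramificationIdx_of_sq_eq {F : Type*} [Field F] [NumberField F] {Q : Ideal (𝓞 F)}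
    [Q.IsPrime] {p d : ℤ} (hp : Prime p) (hpQ : (p : 𝓞 F) ∈ Q) (hpd : p ∣ d) (hsq : Squarefree d)
    {s : F} (hs : s ^ 2 = (d : F)) : 2 ≤ Q.ramificationIdx ℤ := by
  have hsi : IsIntegral ℤ s := IsIntegral.of_pow two_pos (hs ▸ isIntegral_algebraMap (x := d))
  obtain ⟨s', hs'⟩ : ∃ s' : 𝓞 F, (s' : F) = s := ⟨⟨s, hsi⟩, rfl⟩
  have hds : (d : 𝓞 F) = s' ^ 2 := RingOfIntegers.ext (by simp [hs', hs])
  have hdQ2 : (d : 𝓞 F) ∈ Q ^ 2 := by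
    rw [hds]
    refine Ideal.pow_mem_pow (Ideal.IsPrime.mem_of_pow_mem inferInstance 2 ?_) 2
    rw [← hds]
    obtain ⟨e, rfl⟩ := hpd
    push_cast
    exact Ideal.mul_mem_right _ _ hpQ
  have hpQ2 : (p : 𝓞 F) ∈ Q ^ 2 := by
    obtain ⟨e, rfl⟩ := hpd
    -- `p` is a combination of `p ^ 2` and `d = p e`
    have hcop : IsCoprime p e := by
      rw [Prime.coprime_iff_not_dvd hp]
      rintro ⟨f, rfl⟩
      exact hp.not_isUnit (hsq p ⟨f, by ring⟩)
    obtain ⟨u, v, huv⟩ := hcop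
    have : (p : 𝓞 F) = u * p ^ 2 + v * ((p * e : ℤ) : 𝓞 F) := by
      have h : p = u * p ^ 2 + v * (p * e) := by linear_combination (-p) * huv
      exact_mod_cast congrArg (Int.cast (R := 𝓞 F)) h
    rw [this]
    exact add_mem (Ideal.mul_mem_left _ _ (Ideal.pow_mem_pow hpQ 2)) (Ideal.mul_mem_left _ _ hdQ2)
  have : Q.LiesOver (Ideal.span {p}) :=
    (Ideal.liesOver_span_iff (Ideal.IsPrime.ne_top inferInstance) hp).2 hpQ
  have hp0 : Ideal.map (algebraMap ℤ (𝓞 F)) (Ideal.span {p}) ≠ ⊥ := by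
    rw [Ideal.map_span, Set.image_singleton, ne_eq, Ideal.span_singleton_eq_bot, eq_intCast]
    exact_mod_cast hp.ne_zero
  rw [Ideal.IsDedekindDomain.ramificationIdx_eq_multiplicity (Ideal.span {p}) Q hp0]
  have hfin : FiniteMultiplicity Q (Ideal.map (algebraMap ℤ (𝓞 F)) (Ideal.span {p})) :=
    FiniteMultiplicity.of_not_isUnit (by simpa using Ideal.IsPrime.ne_top inferInstance) hp0
  refine hfin.le_multiplicity_of_pow_dvd ?_
  rw [Ideal.dvd_iff_le, Ideal.map_span, Set.image_singleton, Ideal.span_singleton_le_iff_mem]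
  simpa using hpQ2

theorem exists_prime_mem {M : Type*} [Field M] [NumberField M] {P : Ideal (𝓞 M)} (hP : P.IsPrime)
    (hP0 : P ≠ ⊥) : ∃ p : ℕ, p.Prime ∧ ((p : ℤ) : 𝓞 M) ∈ P := by
  have h0 : P.under ℤ ≠ ⊥ := Ideal.IsIntegral.comap_ne_bot ℤ hP0
  have hg := Submodule.IsPrincipal.prime_generator_of_isPrime (P.under ℤ) h0
  refine ⟨_, Int.prime_iff_natAbs_prime.1 hg, ?_⟩
  have hmem := Ideal.mem_of_dvd (P.under ℤ) (Int.dvd_natAbs.2 dvd_rfl)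
    (Submodule.IsPrincipal.generator_mem (P.under ℤ))
  rwa [Ideal.under_def, Ideal.mem_comap, eq_intCast] at hmem

theorem Ideal.intCast_notMem_of_isCoprime {R : Type*} [CommRing R] {I : Ideal R} (hI : I ≠ ⊤)
    {a b : ℤ} (hab : IsCoprime a b) (ha : (a : R) ∈ I) : (b : R) ∉ I := by
  intro hb
  obtain ⟨u, v, huv⟩ := hab
  have h := add_mem (I.mul_mem_left (u : R) ha) (I.mul_mem_left (v : R) hb)
  have h1 : (u : R) * a + v * b = 1 := by exact_mod_cast congrArg (Int.cast (R := R)) huv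
  rw [h1] at h
  exact hI ((Ideal.eq_top_iff_one _).2 h)

/-- The local factors `d p = ± p ≡ 1 mod 4` are distinct primes up to sign, so that their product
is squarefree and congruent to `1` modulo `4`. -/
theorem squarefree_prod_and_modEq {S : Finset ℕ} (hS : ∀ p ∈ S, p.Prime) {d : ℕ → ℤ}
    (hd : ∀ p ∈ S, (d p).natAbs = p ∧ d p ≡ 1 [ZMOD 4]) :
    (∏ p ∈ S, d p).natAbs = ∏ p ∈ S, p ∧ Squarefree (∏ p ∈ S, d p) ∧
      ∏ p ∈ S, d p ≡ 1 [ZMOD 4] := by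
  have habs : (∏ p ∈ S, d p).natAbs = ∏ p ∈ S, p := by
    rw [← Int.natAbsHom_apply, map_prod]
    exact Finset.prod_congr rfl fun p hp => (hd p hp).1
  refine ⟨habs, ?_, ?_⟩
  · rw [← Int.squarefree_natAbs, habs]
    exact Finset.squarefree_prod_of_pairwise_isCoprime
      (fun p hp q hq hpq => Nat.coprime_iff_isRelPrime.1
        ((Nat.coprime_primes (hS p hp) (hS q hq)).2 hpq))
      fun p hp => (hS p hp).prime.squarefree
  · have : ∏ p ∈ S, d p ≡ ∏ p ∈ S, 1 [ZMOD 4] := Int.ModEq.prod fun p hp => (hd p hp).2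
    simpa using this

/-! ### Absorbing the ramification into a quadratic field -/

theorem mainTheorem7 {K : Type*} [Field K] [NumberField K] [IsGalois ℚ K]
    (hram : IsQuadraticallyRamified K) (hodd : Odd (discr K))
    -- the local discriminants `d_p`, equal to `1` for `p ∤ D_K`, and their product
    (d : ℕ → ℤ)
    (hd : ∀ (p : ℕ) [Fact p.Prime], (p : ℤ) ∣ discr K → IsRamifiedLocalDiscriminant p K (d p))
    (dhat : ℤ) (hdhat : dhat = ∏ p ∈ (discr K).natAbs.primeFactors, d p) :
    (Module.finrank ℚ K ≠ 1 → IsQuadraticDiscriminant dhat) ∧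
    -- for `F = ℚ(√dhat)` and the compositum `M = K F`
    ∀ {F M : Type*} [Field F] [NumberField F] [Field M] [NumberField M] [Algebra K M] [Algebra F M]
      (s : F), s ^ 2 = (dhat : F) → IntermediateField.adjoin ℚ {s} = ⊤ →
      (IsScalarTower.toAlgHom ℚ K M).fieldRange ⊔ (IsScalarTower.toAlgHom ℚ F M).fieldRange = ⊤ →
      IsUnramifiedAtFinitePrimes F M := by
  have hprime {p : ℕ} (hp : p ∈ (discr K).natAbs.primeFactors) : p.Prime :=
    Nat.prime_of_mem_primeFactors hp
  have hne2 {p : ℕ} (hp : (p : ℤ) ∣ discr K) : p ≠ 2 := by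
    rintro rfl
    exact (Int.not_even_iff_odd.2 hodd) (even_iff_two_dvd.2 (by exact_mod_cast hp))
  have hdp : ∀ p ∈ (discr K).natAbs.primeFactors, (d p).natAbs = p ∧ d p ≡ 1 [ZMOD 4] := by
    intro p hp
    have : Fact p.Prime := ⟨hprime hp⟩
    have hdvd : (p : ℤ) ∣ discr K := Int.natCast_dvd.2 (Nat.dvd_of_mem_primeFactors hp)
    exact (hd p hdvd).natAbs_eq (hne2 hdvd)
  obtain ⟨habs, hsq, h4⟩ := squarefree_prod_and_modEq (fun p hp => hprime hp) hdp
  rw [← hdhat] at habs hsq h4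
  have hdvd_iff {p : ℕ} (hp : p.Prime) : (p : ℤ) ∣ dhat ↔ (p : ℤ) ∣ discr K := by
    rw [Int.natCast_dvd, Int.natCast_dvd, habs, hp.prime.dvd_finsetProd_iff]
    constructor
    · rintro ⟨q, hq, hpq⟩
      rw [(Nat.prime_dvd_prime_iff_eq hp (hprime hq)).1 hpq]
      exact Nat.dvd_of_mem_primeFactors hq
    · intro h
      exact ⟨p, Nat.mem_primeFactors.2 ⟨hp, h, by simpa using discr_ne_zero K⟩, dvd_rfl⟩
  refine ⟨fun hK => isQuadraticDiscriminant_of_squarefree hsq h4 ?_, ?_⟩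
  · -- by Minkowski's bound some prime divides the discriminant
    have h1 : 1 < Module.finrank ℚ K := by
      have : 0 < Module.finrank ℚ K := Module.finrank_pos
      omega
    have h2 := abs_discr_gt_two h1
    rw [Int.abs_eq_natAbs] at h2
    obtain ⟨p, hp, hpd⟩ := Nat.exists_prime_and_dvd (n := (discr K).natAbs) (by omega)
    intro h
    have := (hdvd_iff hp).2 (Int.natCast_dvd.2 hpd)
    rw [h] at this
    exact (Nat.prime_iff_prime_int.1 hp).not_isUnit (isUnit_of_dvd_one this)
  intro F M _ _ _ _ _ _ s hs htop hsup P hP hP0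
  have : IsGalois ℚ F := isGalois_of_adjoin_sqrt hs htop
  have : IsGalois ℚ M := isGalois_of_sup_fieldRange_eq_top hsup
  have hst : algebraMap F M s ^ 2 = (dhat : M) := by rw [← map_pow, hs, map_intCast]
  have hK0 : P.under (𝓞 K) ≠ ⊥ := Ideal.IsIntegral.comap_ne_bot (𝓞 K) hP0
  obtain ⟨p, hp, hpP⟩ := exists_prime_mem hP hP0
  have hpZ := Nat.prime_iff_prime_int.1 hp
  -- an inertia element is trivial once it is trivial on `K` and fixes the square root of `dhat`
  have hone {σ : Gal(M/ℚ)} (hσK : σ.restrictNormal K = 1)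
      (hσs : σ (algebraMap F M s) = algebraMap F M s) : σ = 1 := by
    refine algEquiv_eq_one_of_sup_fieldRange_eq_top htop hsup (fun x => ?_) hσs
    have := AlgEquiv.restrictNormal_commutes σ K x
    rw [hσK] at this
    exact this.symm
  have htower := Ideal.ramificationIdx_tower (R := ℤ) (P.under (𝓞 F)) P
  rw [← card_inertia_eq_ramificationIdx] at htower
  by_cases hpd : (p : ℤ) ∣ discr K
  · have h2 : (2 : 𝓞 M) ∉ P := by
      have hcop : IsCoprime (p : ℤ) ((2 : ℕ) : ℤ) := Nat.isCoprime_iff_coprime.2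
        ((Nat.coprime_primes hp Nat.prime_two).2 (hne2 hpd))
      exact_mod_cast Ideal.intCast_notMem_of_isCoprime hP.ne_top hcop hpP
    have hle : Nat.card (P.inertia Gal(M/ℚ)) ≤ 2 := by
      have : FaithfulSMul Gal(M/ℚ) (𝓞 M) := IsGaloisGroup.faithful ℤ
      refine card_inertia_le_two hP hP0 h2 fun σ hσ => hone ?_ ?_
      · have hmem := restrictNormal_mem_inertia (K := K) hσ
        have hpow : (⟨_, hmem⟩ : (P.under (𝓞 K)).inertia Gal(K/ℚ)) ^ 2 = 1 := by
          rcases hram (P.under (𝓞 K)) inferInstance hK0 with h | h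
          · have := (Nat.card_eq_one_iff_unique.1 h).1
            exact Subsingleton.elim _ _
          · rw [← h]
            exact pow_card_eq_one'
        have hpow' := congrArg Subtype.val hpow
        refine Eq.trans ?_ hpow'
        exact map_pow (AlgEquiv.restrictNormalHom K) σ 2
      · have : σ (algebraMap F M s) ^ 2 = algebraMap F M s ^ 2 := by
          rw [← map_pow, hst, map_intCast]
        rw [pow_two, AlgEquiv.mul_apply]
        rcases sq_eq_sq_iff_eq_or_eq_neg.1 this with h | h
        · rw [h, h]
        · rw [h, map_neg, h, neg_neg]
    have hge : 2 ≤ (P.under (𝓞 F)).ramificationIdx ℤ := by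
      refine two_le_ramificationIdx_of_sq_eq hpZ ?_ ((hdvd_iff hp).2 hpd) hsq hs
      rw [Ideal.under_def, Ideal.mem_comap, map_intCast]
      exact hpP
    have hpos : 0 < P.ramificationIdx (𝓞 F) := Ideal.ramificationIdx_pos P (𝓞 F)
    nlinarith
  · have hcard : Nat.card ((P.under (𝓞 K)).inertia Gal(K/ℚ)) = 1 := by
      have := (not_dvd_discr_iff_forall_mem K (𝓞 K) hpZ).1 hpd (P.under (𝓞 K)) inferInstance
        (by rw [Ideal.under_def, Ideal.mem_comap, map_intCast]; exact hpP)
      rw [card_inertia_eq_ramificationIdx, Ideal.ramificationIdx_eq_one]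
    have hdP : (dhat : 𝓞 M) ∉ P := Ideal.intCast_notMem_of_isCoprime hP.ne_top
      (hpZ.coprime_iff_not_dvd.2 fun h => hpd ((hdvd_iff hp).1 h)) hpP
    have hbot : P.inertia Gal(M/ℚ) = ⊥ := by
      rw [eq_bot_iff]
      intro σ hσ
      refine hone ?_ (apply_eq_of_sq_eq_of_mem_inertia h4 hdP hst hσ)
      have hmem := restrictNormal_mem_inertia (K := K) hσ
      rwa [Subgroup.card_eq_one.1 hcard, Subgroup.mem_bot] at hmem
    rw [hbot, Subgroup.card_bot] at htower
    exact Nat.eq_one_of_mul_eq_one_left htower.symm
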